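/- A signed graph is a finite simple graph in which every edge carries a sign $+1$ or $-1$; the entry of its adjacency matrix at $(u,v)$ is the sign of the edge $uv$ if $u,v$ are adjacent and $0$ otherwise, and its eigenvalues are those of this matrix. It is bipartite if its underlying graph is bipartite. If $\mu$ is an eigenvalue of multiplicity $k$ of a signed graph $G$, a star set for $\mu$ is a set $S$ of $k$ vertices such that $\mu$ is not an eigenvalue of the induced signed subgraph $G-S$; then $G-S$ is called a star complement for $\mu$ in $G$. Let $\mathcal N(\mathcal H)$ be the set of positive integers that have at least one of the forms 1. $2^p$ with $p\ge 1$; 2. $2^p(q^h+1)$ with $p\ge 2$, $h\ge 1$ and $q$ an odd prime; 3. $2^p q(q+1)$ with $p\ge 2$ and $q\equiv 3\pmod 4$ a prime; 4. $q+1$ with $q\equiv 3\pmod 4$ a prime power; 5. $2(q+1)$ with $q\equiv 1\pmod 4$ a prime power. Let $\mathcal N(\mathcal C)$ be the set of odd prime powers ($1$ included). **Theorem.** Let $\mu$ be a real number and $s$ an integer with $s=\mu^2+1\ge 3$ (so that $\mu^2$ is a positive integer). Let $n$ be the maximum order of a signed bipartite graph that has the totally disconnected graph of order $s$ (the graph with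 $s$ vertices and no edges) as a star complement for the eigenvalue $\mu$. Then $$n=\begin{cases}\mu^2+3 & \text{if } \mu^2\equiv 2 \pmod 4,\\ 2\mu^2+1 & \text{if } \mu^2\in\mathcal N(\mathcal H),\\ 2\mu^2+2 & \text{if } \mu^2\in\mathcal N(\mathcal C).\end{cases}$$ In each case the maximum is attained. -/

import Mathlib

/-- A signed graph: a simple graph together with a sign `±1` on every edge. -/
structure SignedGraph (V : Type*) where
  /-- the underlying graph -/
  graph : SimpleGraph V
  /-- the sign function -/
  sign : graph.edgeSet → ℤˣ

namespace SignedGraph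

variable {V : Type*}

open Classical in
/-- The adjacency matrix of a signed graph: the entry at `(u, v)` is the sign of the edge `uv` if
`u` and `v` are adjacent, and `0` otherwise. -/
noncomputable def adjMatrix (G : SignedGraph V) : Matrix V V ℝ :=
  Matrix.of fun u v =>
    if h : G.graph.Adj u v then
      (((G.sign ⟨s(u, v), (SimpleGraph.mem_edgeSet G.graph).2 h⟩ : ℤˣ) : ℤ) : ℝ)
    else 0

/-- The signed subgraph induced by a set of vertices: edges inside the set keep their signs. -/
def induce (G : SignedGraph V) (W : Set V) : SignedGraph W where
  graph := G.graph.induce W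
  sign e := G.sign ((SimpleGraph.Embedding.induce W).mapEdgeSet e)

/-- The eigenspace of the adjacency matrix for `μ`. -/
noncomputable def eigenspace [Fintype V] (G : SignedGraph V) (μ : ℝ) : Submodule ℝ (V → ℝ) :=
  Module.End.eigenspace G.adjMatrix.mulVecLin μ

/-- `μ` is an eigenvalue of the signed graph. -/
def IsEigenvalue [Fintype V] (G : SignedGraph V) (μ : ℝ) : Prop :=
  Module.End.HasEigenvalue G.adjMatrix.mulVecLin μ

/-- The multiplicity of `μ` in the spectrum. As the adjacency matrix is real and symmetric, this is
the dimension of the eigenspace. -/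
noncomputable def multiplicity [Fintype V] (G : SignedGraph V) (μ : ℝ) : ℕ :=
  Module.finrank ℝ (G.eigenspace μ)

open Classical in
/-- `S` is a star set for the eigenvalue `μ`: its size is the multiplicity of `μ`, and `μ` is not
an eigenvalue of the signed graph with the vertices of `S` deleted. -/
def IsStarSet [Fintype V] (G : SignedGraph V) (μ : ℝ) (S : Finset V) : Prop :=
  G.IsEigenvalue μ ∧ S.card = G.multiplicity μ ∧ ¬ (G.induce {v | v ∉ S}).IsEigenvalue μ

/-- The totally disconnected graph of order `s` is a star complement for the eigenvalue `μ`: after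
deletion of some star set for `μ`, there remain `s` vertices and no edges. -/
def HasTotallyDisconnectedStarComplement [Fintype V] (G : SignedGraph V) (μ : ℝ) (s : ℕ) : Prop :=
  ∃ S : Finset V, G.IsStarSet μ S ∧ Nat.card {v | v ∉ S} = s ∧
    (G.induce {v | v ∉ S}).graph = ⊥

/-- The orders of the signed bipartite graphs that have the totally disconnected graph of order `s`
as a star complement for the eigenvalue `μ`. -/
def bipartiteOrders (μ : ℝ) (s : ℕ) : Set ℕ :=
  {n | ∃ G : SignedGraph (Fin n),
    G.graph.IsBipartite ∧ G.HasTotallyDisconnectedStarComplement μ s}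

end SignedGraph

/-- The set `𝒩(ℋ)`: the integers having one of the five classical forms of orders of Hadamard
matrices. -/
def hadamardOrders : Set ℕ :=
  {n |
    (∃ p : ℕ, 1 ≤ p ∧ n = 2 ^ p) ∨
    (∃ p h q : ℕ, 2 ≤ p ∧ 1 ≤ h ∧ q.Prime ∧ Odd q ∧ n = 2 ^ p * (q ^ h + 1)) ∨
    (∃ p q : ℕ, 2 ≤ p ∧ q.Prime ∧ q % 4 = 3 ∧ n = 2 ^ p * q * (q + 1)) ∨
    (∃ q : ℕ, IsPrimePow q ∧ q % 4 = 3 ∧ n = q + 1) ∨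
    (∃ q : ℕ, IsPrimePow q ∧ q % 4 = 1 ∧ n = 2 * (q + 1))}

/-- The set `𝒩(𝒞)` of odd prime powers, with `1` admitted as the zeroth power. -/
def oddPrimePowers : Set ℕ :=
  {n | ∃ p k : ℕ, p.Prime ∧ Odd p ∧ n = p ^ k}

/-! Put `m = μ²`. If `G - S` is edgeless, an eigenvector for `μ ≠ 0` is determined by its values on
`S`, so `S` is a star set iff `S` is nonempty and `B Bᵀ + μ A_S = m I`, with `A_S` the adjacency
matrix of `S` and `B` the signed incidence between `S` and its complement (`isStarSet_iff`). Each
vertex of `S` then has `m` neighbours among the other `m + 1` vertices; for `m ≥ 2` any two share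
one, and bipartiteness forces `A_S = 0`. The problem becomes: how many pairwise orthogonal rows of
length `m + 1` can have one zero each and `±1` elsewhere?

Upper bounds: rank gives `m + 1` (`card_le`); for even `m` parity puts all zeros in one column,
leaving at most `m` (`card_le_of_even`); for `m ≡ 2 mod 4` divisibility by 4 leaves two
(`card_le_two`). They are attained by Paley conference matrices, by Hadamard matrices with a zero
column added, and by an explicit pair of rows. -/

/-! ### Hadamard matrices: products and powers of two. -/

section Constructions

open Matrix

/-- There is a Hadamard matrix of order `n`. -/
def HasHadamardMatrix (n : ℕ) : Prop :=
  ∃ A : Matrix (Fin n) (Fin n) ℤ, A.IsHadamard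

/-- Lets later constructions use any index types and check rows only: for a square matrix, `A Aᵀ = n
I` with `n ≠ 0` already gives column orthogonality. -/
theorem HasHadamardMatrix.of_rows_orthogonal {R C : Type*} [Fintype R] [Fintype C] {n : ℕ}
    (hR : Fintype.card R = n) (hC : Fintype.card C = n) (A : R → C → ℤ)
    (hA : ∀ i j, A i j = 1 ∨ A i j = -1)
    (horth : ∀ i j, i ≠ j → ∑ k, A i k * A j k = 0) : HasHadamardMatrix n := by
  have eR := (Fintype.equivFinOfCardEq hR).symm
  have eC := (Fintype.equivFinOfCardEq hC).symm
  rcases Nat.eq_zero_or_pos n with rfl | hn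
  · exact ⟨1, ⟨fun i => i.elim0, by ext i; exact i.elim0, by ext i; exact i.elim0⟩⟩
  refine ⟨Matrix.of fun i j => A (eR i) (eC j), IsHadamard.of_mul_conjTranspose ?_ ?_ ?_⟩
  · exact fun i j => Unitary.mem_iff_eq_one_or_eq_neg_one.mpr (hA _ _)
  · ext i j
    have h : ∑ k, A (eR i) (eC k) * A (eR j) (eC k) = ∑ k, A (eR i) k * A (eR j) k :=
      eC.sum_comp fun k => A (eR i) k * A (eR j) k
    simp only [mul_apply, of_apply, conjTranspose_apply, star_trivial, h, Matrix.smul_apply, one_apply,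
      Fintype.card_fin, smul_eq_mul]
    split_ifs with hij
    · subst hij
      have h1 : ∀ k, A (eR i) k * A (eR i) k = 1 := fun k => by
        rcases hA (eR i) k with h | h <;> simp [h]
      simp [h1, hC]
    · simpa using horth _ _ (eR.injective.ne hij)
  · exact IsRegular.of_ne_zero (by simpa using hn.ne')

theorem HasHadamardMatrix.mul {m n : ℕ} (hm : HasHadamardMatrix m) (hn : HasHadamardMatrix n) :
    HasHadamardMatrix (m * n) := by
  obtain ⟨A, hA⟩ := hm
  obtain ⟨B, hB⟩ := hn
  exact ⟨_, (hA.kronecker hB).reindex finProdFinEquiv finProdFinEquiv⟩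

theorem hasHadamardMatrix_two : HasHadamardMatrix 2 :=
  .of_rows_orthogonal (R := Bool) (C := Bool) rfl rfl (fun i j => if i && j then -1 else 1)
    (by decide) (by decide)

theorem hasHadamardMatrix_two_pow (p : ℕ) : HasHadamardMatrix (2 ^ p) := by
  induction p with
  | zero =>
    refine .of_rows_orthogonal (R := Unit) (C := Unit) (by simp) (by simp) (fun _ _ => 1)
      (by simp) fun i j h => (h rfl).elim
  | succ p ih => exact pow_succ 2 p ▸ ih.mul hasHadamardMatrix_two

/-! ### Conference and Hadamard matrices from quadratic characters. -/

section Paley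

variable {F : Type*} [Field F] [Fintype F] [DecidableEq F]

/-- Substituting `x = (b - a) y + a` turns the sum into `χ(-1)` times the Jacobi sum of `χ` and `χ⁻¹
= χ`, which is `-χ(-1)`. -/
theorem sum_quadraticChar_sub_mul_quadraticChar_sub (hF : ringChar F ≠ 2) {a b : F} (hab : a ≠ b) :
    ∑ x, quadraticChar F (x - a) * quadraticChar F (x - b) = -1 := by
  set χ := quadraticChar F with hχ
  have hχ1 : χ ≠ 1 := quadraticChar_ne_one hF
  have hinv : χ⁻¹ = χ := (quadraticChar_isQuadratic F).inv
  have hJ := jacobiSum_nontrivial_inv hχ1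
  rw [hinv, jacobiSum] at hJ
  have hd : b - a ≠ 0 := sub_ne_zero.mpr hab.symm
  have hneg : χ (-1) * χ (-1) = 1 := by
    rw [← map_mul]; simp
  have hsq : χ (b - a) * χ (b - a) = 1 := by
    rw [← sq]; exact quadraticChar_sq_one hd
  have he : ∑ x, χ (x - a) * χ (x - b) =
      ∑ y, χ ((b - a) * y) * χ ((b - a) * (y - 1)) := by
    let e : F ≃ F := (Equiv.mulLeft₀ (b - a) hd).trans (Equiv.addRight a)
    rw [← e.sum_comp]
    refine Finset.sum_congr rfl fun y _ => ?_
    simp only [e, Equiv.trans_apply, Equiv.mulLeft₀_apply, Equiv.coe_addRight]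
    congr 2 <;> ring
  have ht : ∀ y, χ ((b - a) * y) * χ ((b - a) * (y - 1)) = χ (-1) * (χ y * χ (1 - y)) := by
    intro y
    have : (y - 1) = -1 * (1 - y) := by ring
    rw [this, map_mul, map_mul, map_mul]
    linear_combination χ y * χ (-1) * χ (1 - y) * hsq
  rw [he, Finset.sum_congr rfl fun y _ => ht y, ← Finset.mul_sum, hJ]
  linear_combination -hneg

theorem sum_quadraticChar_sub (hF : ringChar F ≠ 2) (a : F) :
    ∑ x, quadraticChar F (x - a) = 0 := by
  exact ((Equiv.subRight a).sum_comp fun x => quadraticChar F x).trans (quadraticChar_sum_zero hF)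

theorem sum_quadraticChar_sub_sq (a : F) :
    ∑ x, quadraticChar F (x - a) * quadraticChar F (x - a) = (Fintype.card F : ℤ) - 1 := by
  have h : ∀ x, quadraticChar F (x - a) * quadraticChar F (x - a) = 1 - if x = a then 1 else 0 := by
    intro x
    split_ifs with h
    · simp [h]
    · rw [← sq, quadraticChar_sq_one (sub_ne_zero.mpr h), sub_zero]
  simp [h, -quadraticChar_apply]

variable (F) in
/-- The Paley conference matrix of order `q + 1`. -/
def paleyConference : Matrix (Option F) (Option F) ℤ
  | none, none => 0
  | none, some _ => 1
  | some _, none => quadraticChar F (-1)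
  | some a, some b => quadraticChar F (b - a)

theorem quadraticChar_neg_one_mul_self :
    quadraticChar F (-1) * quadraticChar F (-1) = 1 := by
  rw [← map_mul]; simp

/-- For two rows indexed by `F`, the border column contributes `χ(-1)² = 1`: it cancels the `-1` of
the character sum, or completes `q - 1` to `q` on the diagonal. -/
theorem paleyConference_mul_transpose (hF : ringChar F ≠ 2) :
    paleyConference F * (paleyConference F)ᵀ = (Fintype.card F : ℤ) • 1 := by
  ext i j
  rw [mul_apply, Fintype.sum_option]
  rcases i with _ | a <;> rcases j with _ | b
  · simp [paleyConference]
  · simp [paleyConference, sum_quadraticChar_sub hF, -quadraticChar_apply]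
  · simp [paleyConference, sum_quadraticChar_sub hF, -quadraticChar_apply]
  · simp only [paleyConference, transpose_apply, quadraticChar_neg_one_mul_self, Matrix.smul_apply,
      one_apply, Option.some.injEq, smul_eq_mul]
    split_ifs with h
    · subst h; rw [sum_quadraticChar_sub_sq]; ring
    · rw [sum_quadraticChar_sub_mul_quadraticChar_sub hF h]; ring

/-- The border entry `χ(-1)` is chosen for this: the matrix is symmetric when `χ(-1) = 1` and skew
when `χ(-1) = -1`. -/
theorem paleyConference_transpose :
    (paleyConference F)ᵀ = quadraticChar F (-1) • paleyConference F := by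
  ext i j
  rcases i with _ | a <;> rcases j with _ | b <;>
    simp only [paleyConference, transpose_apply, Matrix.smul_apply, smul_eq_mul, mul_zero, mul_one,
      quadraticChar_neg_one_mul_self]
  rw [← map_mul]
  congr 1
  ring

theorem paleyConference_apply_self (i : Option F) : paleyConference F i i = 0 := by
  rcases i with _ | a <;> simp [paleyConference]

theorem paleyConference_apply_of_ne {i j : Option F} (hij : i ≠ j) :
    paleyConference F i j = 1 ∨ paleyConference F i j = -1 := by
  rcases i with _ | a <;> rcases j with _ | b
  · exact (hij rfl).elim
  · exact Or.inl rfl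
  · exact quadraticChar_dichotomy (by simp)
  · exact quadraticChar_dichotomy (sub_ne_zero.mpr fun h => hij (by rw [h]))

/-- Here `K` is skew, so in `(1 + K)(1 + K)ᵀ` the linear terms cancel and `1 + K Kᵀ = q + 1`
remains. -/
theorem hasHadamardMatrix_card_add_one (hF : Fintype.card F % 4 = 3) :
    HasHadamardMatrix (Fintype.card F + 1) := by
  have hF2 : ringChar F ≠ 2 := fun h => by
    have := FiniteField.even_card_of_char_two h; omega
  have hχ : quadraticChar F (-1) = -1 := by
    rw [quadraticChar_neg_one_iff_not_isSquare, FiniteField.isSquare_neg_one_iff]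
    exact fun h => h hF
  set K := paleyConference F with hK
  have hT : Kᵀ = -K := by rw [hK, paleyConference_transpose, hχ, neg_smul, one_smul]
  have hM : (1 + K) * (1 + K)ᵀ = ((Fintype.card F : ℤ) + 1) • 1 := by
    have := paleyConference_mul_transpose hF2
    rw [← hK] at this
    rw [transpose_add, transpose_one, add_mul, mul_add, mul_add, this, hT, add_smul]
    simp only [mul_one, one_mul, one_smul]
    abel
  refine .of_rows_orthogonal (R := Option F) (C := Option F) (by simp) (by simp)
    (1 + K : Matrix _ _ ℤ) ?_ ?_
  · intro i j
    by_cases hij : i = j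
    · subst hij; left; simp [hK, paleyConference_apply_self]
    · simpa [hij] using paleyConference_apply_of_ne hij
  · intro i j hij
    have := congrFun (congrFun hM i) j
    simpa only [mul_apply, transpose_apply, Matrix.smul_apply, one_apply_ne hij, smul_zero] using this

/-- Here `K` is symmetric with `K² = q`. The block matrix is `K ⊗ [1 1; 1 -1] + I ⊗ [1 -1; -1 -1]`,
whose cross terms cancel in `A Aᵀ`. -/
theorem hasHadamardMatrix_two_mul_card_add_one (hF : Fintype.card F % 4 = 1) :
    HasHadamardMatrix (2 * (Fintype.card F + 1)) := by
  have hF2 : ringChar F ≠ 2 := fun h => by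
    have := FiniteField.even_card_of_char_two h; omega
  have hχ : quadraticChar F (-1) = 1 := by
    rw [quadraticChar_one_iff_isSquare (by simp), FiniteField.isSquare_neg_one_iff]
    omega
  set K := paleyConference F with hK
  have hT : Kᵀ = K := by rw [hK, paleyConference_transpose, hχ, one_smul]
  have hKK : K * K = (Fintype.card F : ℤ) • 1 := by
    have := paleyConference_mul_transpose hF2
    rwa [← hK, hT] at this
  let A := fromBlocks (K + 1) (K - 1) (K - 1) (-K - 1)
  have hM : A * Aᵀ = (2 * ((Fintype.card F : ℤ) + 1)) • 1 := by
    simp only [A, fromBlocks_transpose, transpose_add, transpose_sub, transpose_neg, transpose_one,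
      hT, fromBlocks_multiply, ← fromBlocks_one, fromBlocks_smul, smul_zero]
    have h2 : (2 * ((Fintype.card F : ℤ) + 1)) • (1 : Matrix (Option F) (Option F) ℤ) =
        K * K + K * K + 1 + 1 := by
      rw [hKK]; module
    rw [h2]
    congr 1 <;> noncomm_ring
  refine .of_rows_orthogonal (R := Option F ⊕ Option F) (C := Option F ⊕ Option F)
    (by simp; ring) (by simp; ring) A ?_ ?_
  · rintro (i | i) (j | j) <;> by_cases hij : i = j
    all_goals first
      | subst hij; simp [A, hK, paleyConference_apply_self]
      | rcases paleyConference_apply_of_ne hij with h | h <;> simp [A, hK, hij, h]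
  · intro i j hij
    have := congrFun (congrFun hM i) j
    simpa [mul_apply, hij, -Fintype.sum_sum_type] using this

/-- Scarpis' construction. -/
theorem hasHadamardMatrix_card_mul_card_add_one (hF : Fintype.card F % 4 = 3) :
    HasHadamardMatrix (Fintype.card F * (Fintype.card F + 1)) := by
  have hF2 : ringChar F ≠ 2 := fun h => by
    have := FiniteField.even_card_of_char_two h; omega
  have hχ : quadraticChar F (-1) = -1 := by
    rw [quadraticChar_neg_one_iff_not_isSquare, FiniteField.isSquare_neg_one_iff]
    exact fun h => h hF
  -- The core of a Hadamard matrix of order `q + 1`: row sums are `-1`, and so are inner products of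
  -- distinct rows.
  let C : F → F → ℤ := fun a b => quadraticChar F (b - a) - if a = b then 1 else 0
  have hC : ∀ a b, C a b = 1 ∨ C a b = -1 := fun a b => by
    by_cases h : a = b
    · simp [C, h]
    · simpa [C, h] using quadraticChar_dichotomy (sub_ne_zero.mpr (Ne.symm h))
  have hsum : ∀ a, ∑ b, C a b = -1 := fun a => by
    simp [C, sum_quadraticChar_sub hF2, -quadraticChar_apply]
  have hself : ∀ a, ∑ b, C a b * C a b = Fintype.card F := fun a => by
    have : ∀ b, C a b * C a b = 1 := fun b => by rcases hC a b with h | h <;> simp [h]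
    simp [this]
  have horth : ∀ a a', a ≠ a' → ∑ b, C a b * C a' b = -1 := fun a a' h => by
    have hx : quadraticChar F (a' - a) = - quadraticChar F (a - a') := by
      rw [← neg_sub, neg_eq_neg_one_mul, map_mul, hχ]; ring
    simp only [C, sub_mul, mul_sub, Finset.sum_sub_distrib,
      sum_quadraticChar_sub_mul_quadraticChar_sub hF2 h]
    simp [hx, h, -quadraticChar_apply]
  let H : F → Option F → ℤ := fun r c => c.elim 1 (C r)
  have hH : ∀ r c, H r c = 1 ∨ H r c = -1 := by
    rintro r (_ | c)
    · exact Or.inl rfl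
    · exact hC r c
  have hHsum : ∀ r, ∑ c, H r c = 0 := fun r => by
    simp [Fintype.sum_option, H, hsum]
  have hHorth : ∀ r r', r ≠ r' → ∑ c, H r c * H r' c = 0 := fun r r' h => by
    simp [Fintype.sum_option, H, horth r r' h]
  -- Columns form `q + 1` blocks. Row `(a, i)` carries row `a` of `C` in block `none` and row `i + a
  -- d` in block `d`, like a line of slope `a`. Two such rows use the same row of `C` in exactly one
  -- block: `none` for equal slopes, the intersection point otherwise. That block gives `q`, the
  -- other `q` blocks give `-1` each.
  let A : F ⊕ F × F → Option F × F → ℤ := fun i c =>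
    i.elim (fun r => H r c.1) fun p => C (c.1.elim p.1 fun d => p.2 + p.1 * d) c.2
  have hmix : ∀ r p, ∑ c, A (.inl r) c * A (.inr p) c = 0 := fun r p => by
    simp only [A, Sum.elim_inl, Sum.elim_inr, Fintype.sum_prod_type, ← Finset.mul_sum, hsum,
      ← Finset.sum_mul, hHsum, zero_mul]
  refine .of_rows_orthogonal (R := F ⊕ F × F) (C := Option F × F) (by simp; ring)
    (by simp; ring) A ?_ ?_
  · rintro (r | p) c
    · exact hH _ _
    · exact hC _ _
  · rintro (r | ⟨a, i⟩) (r' | ⟨a', i'⟩) hij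
    · have : r ≠ r' := fun h => hij (by rw [h])
      simp [A, Fintype.sum_prod_type, ← Finset.mul_sum, hHorth r r' this]
    · exact hmix _ _
    · simpa only [mul_comm] using hmix r' (a, i)
    · simp only [A, Sum.elim_inr, Fintype.sum_prod_type, Fintype.sum_option, Option.elim_none,
        Option.elim_some]
      by_cases ha : a = a'
      · subst ha
        have hi : i ≠ i' := fun h => hij (by rw [h])
        have hi' : ∀ d, i + a * d ≠ i' + a * d := fun d h => hi (add_right_cancel h)
        simp [hself, horth _ _ (hi' _)]
      · have hd : ∀ d, ∑ b, C (i + a * d) b * C (i' + a' * d) b =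
            -1 + if d = (i' - i) / (a - a') then (Fintype.card F : ℤ) + 1 else 0 := fun d => by
          have hiff : i + a * d = i' + a' * d ↔ d = (i' - i) / (a - a') := by
            rw [eq_div_iff (sub_ne_zero.mpr ha)]
            constructor <;> intro h <;> linear_combination h
          split_ifs with h
          · rw [hiff.mpr h, hself]; ring
          · rw [horth _ _ (mt hiff.mp h)]; ring
        simp [hd, horth _ _ ha, Finset.sum_add_distrib]

end Paley

/-! ### The five Hadamard forms. -/

theorem IsPrimePow.exists_field {q : ℕ} (hq : IsPrimePow q) :
    ∃ (F : Type) (_ : Field F) (_ : Fintype F) (_ : DecidableEq F), Fintype.card F = q := by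
  obtain ⟨f⟩ := (Fintype.nonempty_field_iff (α := Fin q)).2 (by simpa using hq)
  exact ⟨Fin q, f, inferInstance, inferInstance, Fintype.card_fin q⟩

theorem hasHadamardMatrix_of_mem_hadamardOrders {n : ℕ} (hn : n ∈ hadamardOrders) :
    HasHadamardMatrix n := by
  have paley1 : ∀ q : ℕ, IsPrimePow q → q % 4 = 3 → HasHadamardMatrix (q + 1) := by
    intro q hq h
    obtain ⟨F, _, _, _, rfl⟩ := hq.exists_field
    exact hasHadamardMatrix_card_add_one h
  have paley2 : ∀ q : ℕ, IsPrimePow q → q % 4 = 1 → HasHadamardMatrix (2 * (q + 1)) := by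
    intro q hq h
    obtain ⟨F, _, _, _, rfl⟩ := hq.exists_field
    exact hasHadamardMatrix_two_mul_card_add_one h
  rcases hn with ⟨p, -, rfl⟩ | ⟨p, h, q, hp, hh, hq, hodd, rfl⟩ | ⟨p, q, -, hq, hq3, rfl⟩ |
    ⟨q, hq, hq3, rfl⟩ | ⟨q, hq, hq1, rfl⟩
  · exact hasHadamardMatrix_two_pow p
  · have hpp : IsPrimePow (q ^ h) := hq.isPrimePow.pow (by omega)
    have hqodd : Odd (q ^ h) := hodd.pow
    rcases Nat.odd_mod_four_iff.mp (Nat.odd_iff.mp hqodd) with h1 | h3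
    · obtain ⟨p, rfl⟩ : ∃ p', p = p' + 1 := ⟨p - 1, by omega⟩
      rw [pow_succ, mul_assoc]
      exact (hasHadamardMatrix_two_pow p).mul (paley2 _ hpp h1)
    · exact (hasHadamardMatrix_two_pow p).mul (paley1 _ hpp h3)
  · obtain ⟨F, _, _, _, rfl⟩ := hq.isPrimePow.exists_field
    rw [mul_assoc]
    exact (hasHadamardMatrix_two_pow p).mul (hasHadamardMatrix_card_mul_card_add_one hq3)
  · exact paley1 q hq hq3
  · exact paley2 q hq hq1

theorem even_of_mem_hadamardOrders {n : ℕ} (hn : n ∈ hadamardOrders) : Even n := by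
  rcases hn with ⟨p, hp, rfl⟩ | ⟨p, h, q, hp, -, -, -, rfl⟩ | ⟨p, q, hp, -, -, rfl⟩ |
    ⟨q, -, hq3, rfl⟩ | ⟨q, -, -, rfl⟩
  · exact (Nat.even_pow.2 ⟨even_two, by omega⟩)
  · exact (Nat.even_pow.2 ⟨even_two, by omega⟩).mul_right _
  · exact ((Nat.even_pow.2 ⟨even_two, by omega⟩).mul_right _).mul_right _
  · rw [Nat.even_iff]; omega
  · exact even_two.mul_right _

end Constructions

/-! ### Orthogonal rows of weight `m`: bounds and examples. -/

section Weighing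

open Matrix

variable {R C : Type*} [Fintype C] [DecidableEq R]

/-- The rows of `M` are pairwise orthogonal vectors of squared norm `m` with entries in
`{0, 1, -1}`. -/
def IsWeighing (M : R → C → ℤ) (m : ℕ) : Prop :=
  (∀ i c, M i c = 0 ∨ M i c = 1 ∨ M i c = -1) ∧
    ∀ i j, ∑ c, M i c * M j c = if i = j then (m : ℤ) else 0

namespace IsWeighing

variable {M : R → C → ℤ} {m : ℕ}

theorem card_le [Fintype R] (hM : IsWeighing M m) (hm : m ≠ 0) : Fintype.card R ≤ Fintype.card C := by
  classical
  let A : Matrix R C ℚ := of fun i c => (M i c : ℚ)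
  have hA : A * Aᵀ = (m : ℚ) • 1 := by
    ext i j
    have h := congrArg (Int.cast : ℤ → ℚ) (hM.2 i j)
    simp only [A, mul_apply, transpose_apply, of_apply, Matrix.smul_apply, one_apply]
    push_cast at h
    rw [h]
    simp
  have hu : IsUnit ((m : ℚ) • (1 : Matrix R R ℚ)) := by
    rw [isUnit_iff_isUnit_det]
    simpa using fun h => (hm h).elim
  calc Fintype.card R = (A * Aᵀ).rank := by rw [hA, rank_of_isUnit _ hu]
    _ ≤ A.rank := rank_mul_le_left _ _
    _ ≤ Fintype.card C := rank_le_card_width _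

theorem exists_zero (hM : IsWeighing M m) (hC : Fintype.card C = m + 1) (i : R) :
    ∃ d, ∀ c, M i c = 0 ↔ c = d := by
  classical
  have h1 : ∀ c, M i c * M i c = 1 - if M i c = 0 then 1 else 0 := fun c => by
    rcases hM.1 i c with h | h | h <;> simp [h]
  have h2 := hM.2 i i
  simp only [h1, Finset.sum_sub_distrib, Finset.sum_boole] at h2
  simp only [Finset.sum_const, Finset.card_univ, hC] at h2
  have h3 : (Finset.univ.filter fun c => M i c = 0).card = 1 := by
    simp at h2; omega
  obtain ⟨d, hd⟩ := Finset.card_eq_one.mp h3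
  refine ⟨d, fun c => ?_⟩
  simpa using Finset.ext_iff.mp hd c

/-- If the zeros of two rows lay in different columns, their inner product would be a sum of `m - 1`
signs, odd for even `m`, hence nonzero. -/
theorem zero_eq_zero (hM : IsWeighing M m) (hC : Fintype.card C = m + 1) (hm : Even m) {i j : R}
    {c d : C} (hc : M i c = 0) (hd : M j d = 0) : c = d := by
  classical
  by_contra hcd
  have hij : i ≠ j := by
    rintro rfl
    obtain ⟨e, he⟩ := hM.exists_zero hC i
    exact hcd (((he c).1 hc).trans ((he d).1 hd).symm)
  obtain ⟨c', hc'⟩ := hM.exists_zero hC i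
  obtain ⟨d', hd'⟩ := hM.exists_zero hC j
  obtain rfl := (hc' c).1 hc
  obtain rfl := (hd' d).1 hd
  -- The subtracted term indicates the columns where both rows are nonzero; it sums to `m - 1`.
  have h : ∀ e, (2 : ℤ) ∣ M i e * M j e -
      (1 - (if e = c then 1 else 0) - if e = d then 1 else 0) := fun e => by
    have h1 := hc' e
    have h2 := hd' e
    by_cases hec : e = c
    · have hed : e ≠ d := fun h => hcd (hec.symm.trans h)
      rw [h1.2 hec]; simp [hec, hcd]
    · by_cases hed : e = d
      · rw [h2.2 hed]; simp [hed, Ne.symm hcd]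
      · have h3 := (hM.1 i e).resolve_left (mt h1.1 hec)
        have h4 := (hM.1 j e).resolve_left (mt h2.1 hed)
        rcases h3 with h3 | h3 <;> rcases h4 with h4 | h4 <;> simp [h3, h4, hec, hed]
  have hs := Finset.dvd_sum (s := Finset.univ) fun e _ => h e
  rw [Finset.sum_sub_distrib, hM.2, if_neg hij] at hs
  simp [hC] at hs
  obtain ⟨t, rfl⟩ := hm
  push_cast at hs
  omega

/-- All zeros share one column; deleting it leaves `m` columns for the rank bound. -/
theorem card_le_of_even [Fintype R] (hM : IsWeighing M m) (hC : Fintype.card C = m + 1)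
    (hm : Even m) (hm0 : m ≠ 0) : Fintype.card R ≤ m := by
  classical
  rcases isEmpty_or_nonempty R with hR | ⟨⟨i₀⟩⟩
  · simp
  obtain ⟨d, hd⟩ := hM.exists_zero hC i₀
  have hz : ∀ i, M i d = 0 := fun i => by
    obtain ⟨e, he⟩ := hM.exists_zero hC i
    rw [he]
    exact hM.zero_eq_zero hC hm ((hd d).2 rfl) ((he e).2 rfl)
  have hM' : IsWeighing (fun i (c : {c // c ≠ d}) => M i c) m := by
    refine ⟨fun i c => hM.1 i c, fun i j => ?_⟩
    rw [← hM.2 i j, ← Finset.add_sum_erase _ _ (Finset.mem_univ d), hz i, zero_mul, zero_add]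
    exact (Finset.sum_subtype _ (by simp) fun c => M i c * M j c).symm
  refine (hM'.card_le hm0).trans ?_
  rw [Fintype.card_subtype_compl, Fintype.card_subtype_eq, hC]
  simp

/-- For three rows `a, b, c`, orthogonality gives `∑ (a + b)(a + c) = ∑ a² = m`. Off the common zero
column both factors are even, so `4 ∣ m`, a contradiction. -/
theorem card_le_two [Fintype R] (hM : IsWeighing M m) (hC : Fintype.card C = m + 1)
    (hm : m % 4 = 2) : Fintype.card R ≤ 2 := by
  by_contra! hR
  obtain ⟨i, j, l, hij, hil, hjl⟩ := Fintype.two_lt_card_iff.mp hR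
  have hev : Even m := by rw [Nat.even_iff]; omega
  have hsum : ∑ c, (M i c + M j c) * (M i c + M l c) = m := by
    have h : ∀ c, (M i c + M j c) * (M i c + M l c) =
      M i c * M i c + M i c * M l c + M j c * M i c + M j c * M l c := fun c => by ring
    simp only [h, Finset.sum_add_distrib, hM.2]
    simp [hil, hij.symm, hjl]
  obtain ⟨d, hd⟩ := hM.exists_zero hC i
  have hdvd : ∀ c, (4 : ℤ) ∣ (M i c + M j c) * (M i c + M l c) := fun c => by
    have hz : ∀ k, M k c = 0 → ∀ k', M k' c = 0 := fun k hk k' => by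
      obtain ⟨e, he⟩ := hM.exists_zero hC k'
      rw [he]
      exact hM.zero_eq_zero hC hev hk ((he e).2 rfl)
    by_cases hc : M i c = 0
    · simp [hz i hc]
    · have h1 := (hM.1 i c).resolve_left hc
      have h2 := (hM.1 j c).resolve_left fun h => hc (hz j h i)
      have h3 := (hM.1 l c).resolve_left fun h => hc (hz l h i)
      rcases h1 with h1 | h1 <;> rcases h2 with h2 | h2 <;> rcases h3 with h3 | h3 <;>
        simp [h1, h2, h3]
  have h4 := Finset.dvd_sum (s := Finset.univ) fun c _ => hdvd c
  rw [hsum] at h4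
  omega

end IsWeighing

theorem exists_isWeighing_two {m : ℕ} (hm : Even m) :
    ∃ M : Fin 2 → Fin (m + 1) → ℤ, IsWeighing M m := by
  obtain ⟨t, rfl⟩ := hm
  let e : Fin (t + t + 1) ≃ Option (Fin t ⊕ Fin t) := (Fintype.equivFinOfCardEq (by simp)).symm
  let N : Fin 2 → Option (Fin t ⊕ Fin t) → ℤ := fun i c =>
    c.elim 0 (Sum.elim (fun _ => 1) fun _ => if i = 0 then 1 else -1)
  refine ⟨fun i c => N i (e c), fun i c => ?_, fun i j => ?_⟩
  · beta_reduce
    generalize e c = x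
    rcases x with _ | x | x
    · simp [N]
    · simp [N]
    · by_cases h : i = 0 <;> simp [N, h]
  · rw [e.sum_comp fun c => N i c * N j c]
    fin_cases i <;> fin_cases j <;> simp [N]

theorem HasHadamardMatrix.exists_isWeighing {m : ℕ} (h : HasHadamardMatrix m) :
    ∃ M : Fin m → Fin (m + 1) → ℤ, IsWeighing M m := by
  obtain ⟨A, hA⟩ := h
  refine ⟨fun i => Fin.cons 0 (A i), fun i c => ?_, fun i j => ?_⟩
  · refine Fin.cases (Or.inl rfl) (fun c => Or.inr ?_) c
    exact Unitary.mem_iff_eq_one_or_eq_neg_one.mp (hA.apply_mem i c)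
  · have := congrFun (congrFun hA.mul_conjTranspose i) j
    simpa [Fin.sum_univ_succ, mul_apply, one_apply] using this

theorem exists_isWeighing_of_mem_oddPrimePowers {m : ℕ} (hm : m ∈ oddPrimePowers) (hm1 : m ≠ 1) :
    ∃ M : Fin (m + 1) → Fin (m + 1) → ℤ, IsWeighing M m := by
  obtain ⟨p, k, hp, hodd, rfl⟩ := hm
  -- The zeroth power 1 is not the order of a field.
  have hk : k ≠ 0 := by rintro rfl; simp at hm1
  obtain ⟨F, _, _, _, hF⟩ := (hp.isPrimePow.pow hk).exists_field
  have hF2 : ringChar F ≠ 2 := fun h => by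
    have := FiniteField.even_card_of_char_two h
    rw [hF] at this
    have h2 := Nat.odd_iff.mp (hodd.pow (n := k))
    omega
  let e : Fin (p ^ k + 1) ≃ Option F := (Fintype.equivFinOfCardEq (by simp [hF])).symm
  refine ⟨fun i c => paleyConference F (e i) (e c), fun i c => ?_, fun i j => ?_⟩
  · by_cases h : e i = e c
    · left; beta_reduce; rw [h, paleyConference_apply_self]
    · exact Or.inr (paleyConference_apply_of_ne h)
  · rw [e.sum_comp fun c => paleyConference F (e i) c * paleyConference F (e j) c]
    have := congrFun (congrFun (paleyConference_mul_transpose hF2) (e i)) (e j)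
    simpa only [mul_apply, transpose_apply, Matrix.smul_apply, one_apply, e.injective.eq_iff,
      smul_eq_mul, mul_ite, mul_one, mul_zero, hF] using this

end Weighing

/-! ### Star sets with edgeless complement and weighing matrices. -/

namespace SignedGraph

section StarSets

open Matrix

variable {V : Type*} (G : SignedGraph V)

theorem adjMatrix_apply_of_not_adj {u v : V} (h : ¬ G.graph.Adj u v) : G.adjMatrix u v = 0 := by
  simp [adjMatrix, h]

theorem adjMatrix_apply_of_adj {u v : V} (h : G.graph.Adj u v) :
    G.adjMatrix u v = 1 ∨ G.adjMatrix u v = -1 := by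
  simp only [adjMatrix, of_apply, dif_pos h]
  rcases Int.units_eq_one_or (G.sign ⟨s(u, v), (SimpleGraph.mem_edgeSet G.graph).2 h⟩) with h | h
    <;> simp [h]

theorem exists_int_adjMatrix_apply (u v : V) :
    ∃ a : ℤ, (a = 0 ∨ a = 1 ∨ a = -1) ∧ (a : ℝ) = G.adjMatrix u v := by
  by_cases h : G.graph.Adj u v
  · rcases G.adjMatrix_apply_of_adj h with h | h
    · exact ⟨1, by simp, by simp [h]⟩
    · exact ⟨-1, by simp, by simp [h]⟩
  · exact ⟨0, by simp, by simp [G.adjMatrix_apply_of_not_adj h]⟩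

theorem adjMatrix_apply_comm (u v : V) : G.adjMatrix u v = G.adjMatrix v u := by
  by_cases h : G.graph.Adj u v
  · simp only [adjMatrix, of_apply, dif_pos h, dif_pos h.symm]
    have : (⟨s(u, v), (SimpleGraph.mem_edgeSet G.graph).2 h⟩ : G.graph.edgeSet) =
      ⟨s(v, u), (SimpleGraph.mem_edgeSet G.graph).2 h.symm⟩ := Subtype.ext Sym2.eq_swap
    rw [this]
  · rw [G.adjMatrix_apply_of_not_adj h, G.adjMatrix_apply_of_not_adj fun h' => h h'.symm]

theorem mem_eigenspace_iff [Fintype V] {μ : ℝ} {x : V → ℝ} :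
    x ∈ G.eigenspace μ ↔ ∀ u, ∑ v, G.adjMatrix u v * x v = μ * x u := by
  rw [eigenspace, Module.End.mem_eigenspace_iff, funext_iff]
  rfl

theorem not_isEigenvalue_of_graph_eq_bot [Fintype V] (hG : G.graph = ⊥) {μ : ℝ} (hμ : μ ≠ 0) :
    ¬ G.IsEigenvalue μ := by
  intro h
  obtain ⟨x, hx, hx0⟩ := h.exists_hasEigenvector
  apply hx0
  funext u
  have hu := G.mem_eigenspace_iff.1 hx u
  have h0 : ∀ v, G.adjMatrix u v = 0 := fun v => G.adjMatrix_apply_of_not_adj (by simp [hG])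
  simpa [h0, hμ] using hu.symm

/-- Outside `S` the eigenvalue equation reads `μ x_w = ∑ v ∈ S, a_wv x_v`, so restriction to `S` is
injective on the eigenspace. The multiplicity equals `|S|` iff it is onto, and the equation at
vertices of `S` then becomes the Gram identity. Nonemptiness of `S` makes `μ` an eigenvalue. -/
theorem isStarSet_iff [Fintype V] [DecidableEq V] {μ : ℝ} (hμ : μ ≠ 0) {S : Finset V}
    (hS : (G.induce {v | v ∉ S}).graph = ⊥) :
    G.IsStarSet μ S ↔ S.Nonempty ∧ ∀ u ∈ S, ∀ v ∈ S,
      μ * G.adjMatrix u v + ∑ w ∈ Sᶜ, G.adjMatrix u w * G.adjMatrix v w =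
        if u = v then μ ^ 2 else 0 := by
  classical
  have h0 : ∀ w ∉ S, ∀ z ∉ S, G.adjMatrix w z = 0 := fun w hw z hz => by
    refine G.adjMatrix_apply_of_not_adj fun h => ?_
    have h' : (G.induce {v | v ∉ S}).graph.Adj ⟨w, hw⟩ ⟨z, hz⟩ := h
    rw [hS] at h'
    exact h'
  have hout : ∀ (x : V → ℝ), ∀ w ∉ S,
      ∑ v, G.adjMatrix w v * x v = ∑ v ∈ S, G.adjMatrix w v * x v := fun x w hw => by
    rw [← Finset.sum_add_sum_compl S, add_eq_left]
    exact Finset.sum_eq_zero fun z hz => by rw [h0 w hw z (Finset.mem_compl.1 hz), zero_mul]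
  let φ : G.eigenspace μ →ₗ[ℝ] (S → ℝ) :=
    (LinearMap.funLeft ℝ ℝ (Subtype.val : S → V)) ∘ₗ (G.eigenspace μ).subtype
  have hφ : ∀ x v, φ x v = x.1 v := fun x v => rfl
  have hinj : Function.Injective φ := by
    rw [← LinearMap.ker_eq_bot, LinearMap.ker_eq_bot']
    intro x hx
    have hxS : ∀ v ∈ S, x.1 v = 0 := fun v hv => by
      rw [← hφ x ⟨v, hv⟩, hx]; rfl
    ext u
    by_cases hu : u ∈ S
    · exact hxS u hu
    · have := G.mem_eigenspace_iff.1 x.2 u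
      rw [hout _ _ hu, Finset.sum_eq_zero fun v hv => by rw [hxS v hv, mul_zero]] at this
      simpa [hμ] using this.symm
  have hdim : Module.finrank ℝ (S → ℝ) = S.card := by simp
  constructor
  · rintro ⟨hev, hcard, -⟩
    have hfin : Module.finrank ℝ (G.eigenspace μ) = Module.finrank ℝ (S → ℝ) := by
      rw [hdim, hcard, multiplicity]
    have hsurj := (LinearMap.injective_iff_surjective_of_finrank_eq_finrank hfin).1 hinj
    constructor
    · rw [← Finset.card_ne_zero, hcard, multiplicity]
      intro h
      exact hev (Submodule.finrank_eq_zero.1 h)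
    · intro u hu v hv
      -- The eigenvector restricting to the indicator of `v` has value `a_wv / μ` at each `w`
      -- outside `S`; its equation at `u` is the wanted entry.
      obtain ⟨x, hx⟩ := hsurj (Pi.single ⟨v, hv⟩ 1)
      have hxS : ∀ w ∈ S, x.1 w = if w = v then 1 else 0 := fun w hw => by
        rw [← hφ x ⟨w, hw⟩, hx, Pi.single_apply]; simp
      have hxw : ∀ w ∈ Sᶜ, μ * x.1 w = G.adjMatrix w v := fun w hw => by
        rw [← G.mem_eigenspace_iff.1 x.2 w, hout _ _ (Finset.mem_compl.1 hw),
          Finset.sum_congr rfl fun z hz => by rw [hxS z hz]]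
        simp [hv]
      have hxu := G.mem_eigenspace_iff.1 x.2 u
      rw [← Finset.sum_add_sum_compl S, Finset.sum_congr rfl fun z hz => by rw [hxS z hz],
        hxS u hu] at hxu
      simp only [mul_ite, mul_one, mul_zero, Finset.sum_ite_eq', hv, if_true] at hxu
      have h2 : ∑ w ∈ Sᶜ, G.adjMatrix u w * G.adjMatrix v w =
          μ * ∑ w ∈ Sᶜ, G.adjMatrix u w * x.1 w := by
        rw [Finset.mul_sum]
        refine Finset.sum_congr rfl fun w hw => ?_
        rw [G.adjMatrix_apply_comm v w, ← hxw w hw]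
        ring
      rw [h2, ← mul_add, hxu]
      split_ifs <;> ring
  · rintro ⟨hne, hgram⟩
    have hsurj : Function.Surjective φ := by
      intro y
      let y' : V → ℝ := fun v => if hv : v ∈ S then y ⟨v, hv⟩ else 0
      let x : V → ℝ := fun u => if u ∈ S then y' u else μ⁻¹ * ∑ v ∈ S, G.adjMatrix u v * y' v
      have hxS : ∀ u ∈ S, x u = y' u := fun u hu => if_pos hu
      have hx : x ∈ G.eigenspace μ := by
        rw [mem_eigenspace_iff]
        intro u
        by_cases hu : u ∈ S
        · have hxC : ∀ w ∈ Sᶜ, G.adjMatrix u w * x w =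
              μ⁻¹ * ∑ v ∈ S, G.adjMatrix u w * G.adjMatrix v w * y' v := fun w hw => by
            have : x w = μ⁻¹ * ∑ v ∈ S, G.adjMatrix w v * y' v :=
              if_neg (Finset.mem_compl.1 hw)
            rw [this, mul_left_comm, Finset.mul_sum]
            congr 1
            refine Finset.sum_congr rfl fun v _ => ?_
            rw [G.adjMatrix_apply_comm v w, mul_assoc]
          rw [← Finset.sum_add_sum_compl S, Finset.sum_congr rfl hxC, ← Finset.mul_sum,
            Finset.sum_comm, hxS u hu,
            Finset.sum_congr rfl fun v hv => by rw [hxS v hv]]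
          apply mul_left_cancel₀ hμ
          rw [mul_add, mul_inv_cancel_left₀ hμ, Finset.mul_sum, ← Finset.sum_add_distrib]
          have : ∀ v ∈ S, μ * (G.adjMatrix u v * y' v) +
              ∑ w ∈ Sᶜ, G.adjMatrix u w * G.adjMatrix v w * y' v =
                if u = v then μ ^ 2 * y' v else 0 := fun v hv => by
            rw [← Finset.sum_mul, ← mul_assoc, ← add_mul, hgram u hu v hv]
            split_ifs <;> simp
          rw [Finset.sum_congr rfl this]
          simp only [Finset.sum_ite_eq, hu, if_true]
          ring
        · rw [hout _ _ hu]
          have : x u = μ⁻¹ * ∑ v ∈ S, G.adjMatrix u v * y' v := if_neg hu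
          rw [this, mul_inv_cancel_left₀ hμ]
          exact Finset.sum_congr rfl fun v hv => by rw [hxS v hv]
      refine ⟨⟨x, hx⟩, funext fun v => ?_⟩
      exact (hxS v v.2).trans (by simp [y'])
    have hcard : S.card = G.multiplicity μ := by
      rw [← hdim, multiplicity]
      exact (LinearEquiv.ofBijective φ ⟨hinj, hsurj⟩).finrank_eq.symm
    have hno := fun i => @not_isEigenvalue_of_graph_eq_bot _ (G.induce {v | v ∉ S}) i hS μ hμ
    refine ⟨fun h => ?_, hcard, hno _⟩

    have h' : G.eigenspace μ = ⊥ := h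
    rw [multiplicity, h', finrank_bot] at hcard
    exact hne.card_pos.ne' hcard

theorem exists_isWeighing_of_mem_bipartiteOrders {μ : ℝ} {m n : ℕ} (hm : (m : ℝ) = μ ^ 2)
    (hm2 : 2 ≤ m) (hn : n ∈ bipartiteOrders μ (m + 1)) :
    ∃ (k : ℕ) (M : Fin k → Fin (m + 1) → ℤ), n = m + 1 + k ∧ IsWeighing M m := by
  classical
  obtain ⟨G, hbip, S, hstar, hcard, hbot⟩ := hn
  have hμ : μ ≠ 0 := by
    rintro rfl
    have : m = 0 := Nat.cast_eq_zero.1 (hm.trans (zero_pow two_ne_zero))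
    omega
  obtain ⟨-, hgram⟩ := (G.isStarSet_iff hμ hbot).1 hstar
  have hcardC : Fintype.card {v // v ∈ Sᶜ} = m + 1 := by
    rw [← Nat.card_eq_fintype_card, ← hcard]
    exact Nat.card_congr (Equiv.subtypeEquivRight fun v => by simp)
  have hSc : Sᶜ.card = m + 1 := by rw [← hcardC, Fintype.card_coe]
  have hnbr : ∀ u ∈ S, (Sᶜ.filter fun w => G.graph.Adj u w).card = m := fun u hu => by
    have h := hgram u hu u hu
    rw [if_pos rfl, G.adjMatrix_apply_of_not_adj (G.graph.irrefl), mul_zero, zero_add, ← hm] at h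
    have h1 : ∀ w ∈ Sᶜ, G.adjMatrix u w * G.adjMatrix u w =
        if G.graph.Adj u w then 1 else 0 := fun w _ => by
      split_ifs with hw
      · rcases G.adjMatrix_apply_of_adj hw with h | h <;> simp [h]
      · simp [G.adjMatrix_apply_of_not_adj hw]
    rw [Finset.sum_congr rfl h1, Finset.sum_boole] at h
    exact_mod_cast h
  -- Two sets of `m` neighbours among `m + 1` vertices meet, since `2m > m + 1`; an edge `uv` would
  -- close a triangle.
  have hind : ∀ u ∈ S, ∀ v ∈ S, ¬ G.graph.Adj u v := fun u hu v hv huv => by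
    obtain ⟨w, hw⟩ : ((Sᶜ.filter fun w => G.graph.Adj u w) ∩
        (Sᶜ.filter fun w => G.graph.Adj v w)).Nonempty := by
      rw [← Finset.card_pos]
      have h1 := Finset.card_union_add_card_inter (Sᶜ.filter fun w => G.graph.Adj u w)
        (Sᶜ.filter fun w => G.graph.Adj v w)
      have h2 : ((Sᶜ.filter fun w => G.graph.Adj u w) ∪
          (Sᶜ.filter fun w => G.graph.Adj v w)).card ≤ Sᶜ.card :=
        Finset.card_le_card (Finset.union_subset (Finset.filter_subset _ _)
          (Finset.filter_subset _ _))
      rw [hnbr u hu, hnbr v hv] at h1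
      omega
    simp only [Finset.mem_inter, Finset.mem_filter] at hw
    obtain ⟨c⟩ := hbip
    have h1 := c.valid huv
    have h2 := c.valid hw.1.2
    have h3 := c.valid hw.2.2
    omega
  choose a ha haG using G.exists_int_adjMatrix_apply
  let e : Fin S.card ≃ {v // v ∈ S} := S.equivFin.symm
  let f : Fin (m + 1) ≃ {v // v ∈ Sᶜ} := (Fintype.equivFinOfCardEq hcardC).symm
  refine ⟨S.card, fun i c => a (e i) (f c), ?_, fun i c => ha _ _, fun i j => ?_⟩
  · have := S.card_compl_add_card
    rw [Fintype.card_fin] at this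
    omega
  · have h := hgram _ (e i).2 _ (e j).2
    rw [G.adjMatrix_apply_of_not_adj (hind _ (e i).2 _ (e j).2), mul_zero, zero_add, ← hm,
      ← Finset.sum_coe_sort] at h
    rw [f.sum_comp fun c => a (e i) c * a (e j) c]
    simp only [← haG, Subtype.coe_injective.eq_iff, e.injective.eq_iff] at h
    exact_mod_cast h

/-- The signed graph with a given symmetric adjacency matrix. -/
noncomputable def ofMatrix (A : V → V → ℤ) (hsymm : ∀ u v, A u v = A v u) (hdiag : ∀ u, A u u = 0) :
    SignedGraph V where
  graph :=
    { Adj := fun u v => A u v ≠ 0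
      symm := ⟨fun u v h => by rwa [hsymm v u]⟩
      loopless := ⟨fun u h => h (hdiag u)⟩ }
  sign e := if Sym2.lift ⟨A, hsymm⟩ e.1 = 1 then 1 else -1

theorem ofMatrix_adjMatrix_apply {A : V → V → ℤ} (hsymm : ∀ u v, A u v = A v u)
    (hdiag : ∀ u, A u u = 0) {u v : V} (h : A u v = 0 ∨ A u v = 1 ∨ A u v = -1) :
    (ofMatrix A hsymm hdiag).adjMatrix u v = A u v := by
  rcases h with h | h | h <;> simp [adjMatrix, ofMatrix, h]

/-- The graph has `M` as its signed biadjacency matrix and the rows as star set; `k ≠ 0` keeps that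
set nonempty. -/
theorem mem_bipartiteOrders_of_isWeighing {μ : ℝ} {m k s : ℕ} (hm : (m : ℝ) = μ ^ 2)
    (hm0 : m ≠ 0) (hk : k ≠ 0) {M : Fin k → Fin s → ℤ} (hM : IsWeighing M m) :
    k + s ∈ bipartiteOrders μ s := by
  classical
  have hμ : μ ≠ 0 := by
    rintro rfl
    exact hm0 (Nat.cast_eq_zero.1 (hm.trans (zero_pow two_ne_zero)))
  let e : Fin k ⊕ Fin s ≃ Fin (k + s) := finSumFinEquiv
  let B : Matrix (Fin k ⊕ Fin s) (Fin k ⊕ Fin s) ℤ := fromBlocks 0 (of M) (of M)ᵀ 0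
  have hB : ∀ x y, B x y = B y x := by
    rintro (x | x) (y | y) <;> simp [B]
  have hBd : ∀ x, B x x = 0 := by
    rintro (x | x) <;> simp [B]
  have hBe : ∀ x y, B x y = 0 ∨ B x y = 1 ∨ B x y = -1 := by
    rintro (x | x) (y | y)
    · simp [B]
    · exact hM.1 x y
    · exact hM.1 y x
    · simp [B]
  let A : Fin (k + s) → Fin (k + s) → ℤ := fun u v => B (e.symm u) (e.symm v)
  let G := ofMatrix A (fun u v => hB _ _) (fun u => hBd _)
  have hG : ∀ x y, G.adjMatrix (e x) (e y) = B x y := fun x y =>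
    (ofMatrix_adjMatrix_apply (A := A) _ _ (hBe _ _)).trans (by simp [A])
  let S : Finset (Fin (k + s)) := Finset.univ.map (Function.Embedding.inl.trans e.toEmbedding)
  have hSl : ∀ i, e (.inl i) ∈ S := fun i => by simp [S]
  have hSr : ∀ i, e (.inr i) ∉ S := fun i => by simp [S]
  have hbot : (G.induce {v | v ∉ S}).graph = ⊥ := by
    ext ⟨u, hu⟩ ⟨v, hv⟩
    obtain ⟨x | x, rfl⟩ := e.surjective u
    · exact (hu (hSl x)).elim
    obtain ⟨y | y, rfl⟩ := e.surjective v
    · exact (hv (hSl y)).elim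
    simp [induce, G, A, ofMatrix, B]
  have hSc : Sᶜ = Finset.univ.map (Function.Embedding.inr.trans e.toEmbedding) := by
    ext v
    obtain ⟨y | y, rfl⟩ := e.surjective v <;> simp [S]
  refine ⟨G, ⟨SimpleGraph.Coloring.mk (fun u => if (e.symm u).isLeft then 0 else 1) ?_⟩, S,
    (G.isStarSet_iff hμ hbot).2 ⟨?_, ?_⟩, ?_, hbot⟩
  · intro u v h
    obtain ⟨x, rfl⟩ := e.surjective u
    obtain ⟨y, rfl⟩ := e.surjective v
    rcases x with x | x <;> rcases y with y | y <;> simp [G, A, ofMatrix, B] at h ⊢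
  · exact ⟨_, hSl ⟨0, Nat.pos_of_ne_zero hk⟩⟩
  · intro u hu v hv
    obtain ⟨x | x, rfl⟩ := e.surjective u
    swap; · exact (hSr x hu).elim
    obtain ⟨y | y, rfl⟩ := e.surjective v
    swap; · exact (hSr y hv).elim
    have h := congrArg (Int.cast : ℤ → ℝ) (hM.2 x y)
    rw [hSc, Finset.sum_map, ← hm]
    simp only [Function.Embedding.trans_apply, Function.Embedding.inr_apply,
      Equiv.coe_toEmbedding, hG, e.injective.eq_iff, Sum.inl_injective.eq_iff]
    push_cast at h
    simpa [B] using h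
  · have : {v | v ∉ S} = ((Sᶜ : Finset _) : Set (Fin (k + s))) := by ext; simp
    rw [this, Nat.card_coe_set_eq, Set.ncard_coe_finset, hSc]
    simp

end StarSets

end SignedGraph

/-! ### The maximum orders. -/

open SignedGraph in
theorem mainTheorem2 (μ : ℝ) (s : ℕ) (hs : (s : ℝ) = μ ^ 2 + 1) (hs3 : 3 ≤ s) :
    ∃ m : ℕ, (m : ℝ) = μ ^ 2 ∧
      (m % 4 = 2 → IsGreatest (SignedGraph.bipartiteOrders μ s) (m + 3)) ∧
      (m ∈ hadamardOrders → IsGreatest (SignedGraph.bipartiteOrders μ s) (2 * m + 1)) ∧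
      (m ∈ oddPrimePowers → IsGreatest (SignedGraph.bipartiteOrders μ s) (2 * m + 2)) := by
  obtain ⟨m, rfl⟩ : ∃ m, s = m + 1 := ⟨s - 1, by omega⟩
  have hm : (m : ℝ) = μ ^ 2 := by push_cast at hs; linarith
  have hm2 : 2 ≤ m := by omega
  have hm0 : m ≠ 0 := by omega
  refine ⟨m, hm, fun hmod => ⟨?_, fun n hn => ?_⟩, fun hmem => ⟨?_, fun n hn => ?_⟩,
    fun hmem => ⟨?_, fun n hn => ?_⟩⟩
  · obtain ⟨M, hM⟩ := exists_isWeighing_two (m := m) (Nat.even_iff.2 (by omega))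
    have h := mem_bipartiteOrders_of_isWeighing hm hm0 two_ne_zero hM
    rwa [show m + 3 = 2 + (m + 1) by ring]
  · obtain ⟨k, M, rfl, hM⟩ := exists_isWeighing_of_mem_bipartiteOrders hm hm2 hn
    have := hM.card_le_two (by simp) hmod
    rw [Fintype.card_fin] at this
    omega
  · obtain ⟨M, hM⟩ := (hasHadamardMatrix_of_mem_hadamardOrders hmem).exists_isWeighing
    have h := mem_bipartiteOrders_of_isWeighing hm hm0 hm0 hM
    rwa [show 2 * m + 1 = m + (m + 1) by ring]
  · obtain ⟨k, M, rfl, hM⟩ := exists_isWeighing_of_mem_bipartiteOrders hm hm2 hn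
    have := hM.card_le_of_even (by simp) (even_of_mem_hadamardOrders hmem) hm0
    rw [Fintype.card_fin] at this
    omega
  · obtain ⟨M, hM⟩ := exists_isWeighing_of_mem_oddPrimePowers hmem (by omega)
    have h := mem_bipartiteOrders_of_isWeighing hm hm0 m.succ_ne_zero hM
    rwa [show 2 * m + 2 = m + 1 + (m + 1) by ring]
  · obtain ⟨k, M, rfl, hM⟩ := exists_isWeighing_of_mem_bipartiteOrders hm hm2 hn
    have := hM.card_le hm0
    rw [Fintype.card_fin, Fintype.card_fin] at this
    omega
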